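/- For a prime power $q$ and integers $1\le k<n$, a subspace code in $\mathcal G_q(k,n)$ is a set $\mathcal C$ of at least two $k$-dimensional subspaces of $\mathbb F_q^n$. Put $d(U,V)=\dim U+\dim V-2\dim(U\cap V)$ and $d(\mathcal C)=\min\{d(U,V): U,V\in\mathcal C,\ U\neq V\}$. The code $\mathcal C$ is equidistant if $d(U,V)=d(\mathcal C)$ for all distinct $U,V\in\mathcal C$, and an equidistant code is $c$-intersecting if $d(\mathcal C)=2(k-c)$. It is a sunflower if there is a subspace $Z\subseteq\mathbb F_q^n$ with $U\cap V=Z$ for all distinct $U,V\in\mathcal C$. For $0\le c\le k-1$, let $e_q(k,n,c)$ be the largest cardinality of a $c$-intersecting equidistant code in $\mathcal G_q(k,n)$. **Proposition.** Let $k\ge 1$ and $n$ be integers with $n\ge 3k-1$. There is a $Q$, depending only on $k$ and $n$, such that for every prime power $q\ge Q$ and every integer $c$ with $0\le c\le k-1$: 1. $e_q(k,n,c)=e_q(k-c,n-c,0)$; 2. every $c$-intersecting equidistant code $\mathcal C\subseteq\mathcal G_q(k,n)$ with $|\mathcal C|=e_q(k,n,c)$ is a sunflower. -/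

import Mathlib

namespace SubspaceCodes

open Module

/-- The subspace distance `d(U, V) = dim U + dim V - 2 dim (U ∩ V)` on subspaces of `F ^ n`.
The subtraction never truncates, since `dim (U ∩ V) ≤ dim U, dim V`. -/
noncomputable def subspaceDist {F : Type*} [Field F] {n : ℕ}
    (U V : Submodule F (Fin n → F)) : ℕ :=
  finrank F U + finrank F V - 2 * finrank F (U ⊓ V : Submodule F (Fin n → F))

/-- A subspace code of constant dimension `k` in `F ^ n`: a set of at least two `k`-dimensional
subspaces. -/
def IsSubspaceCode {F : Type*} [Field F] {n : ℕ} (k : ℕ)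
    (C : Set (Submodule F (Fin n → F))) : Prop :=
  (∀ U ∈ C, finrank F U = k) ∧ 2 ≤ C.ncard

/-- The minimum distance `d(C)`: the minimum of `d(U, V)` over distinct `U, V` in `C`. -/
noncomputable def minDist {F : Type*} [Field F] {n : ℕ}
    (C : Set (Submodule F (Fin n → F))) : ℕ :=
  sInf {d : ℕ | ∃ U ∈ C, ∃ V ∈ C, U ≠ V ∧ d = subspaceDist U V}

/-- An equidistant code of constant dimension `k`. -/
def IsEquidistant {F : Type*} [Field F] {n : ℕ} (k : ℕ)
    (C : Set (Submodule F (Fin n → F))) : Prop :=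
  IsSubspaceCode k C ∧ ∀ U ∈ C, ∀ V ∈ C, U ≠ V → subspaceDist U V = minDist C

/-- An equidistant code of constant dimension `k` is `c`-intersecting if `d(C) = 2 (k - c)`. -/
def IsEquidistantIntersecting {F : Type*} [Field F] {n : ℕ} (k c : ℕ)
    (C : Set (Submodule F (Fin n → F))) : Prop :=
  IsEquidistant k C ∧ (minDist C : ℤ) = 2 * ((k : ℤ) - (c : ℤ))

/-- `e_q(k, n, c)` for the finite field `F` with `q` elements: the largest cardinality of an
equidistant `c`-intersecting code of `k`-dimensional subspaces of `F ^ n`. -/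
noncomputable def maxCard (F : Type*) [Field F] (k n c : ℕ) : ℕ :=
  sSup {m : ℕ | ∃ C : Set (Submodule F (Fin n → F)),
    IsEquidistantIntersecting k c C ∧ C.ncard = m}

/-- A sunflower: a subspace code with a subspace `Z` (the center) such that `U ∩ V = Z` for all
distinct `U, V` in the code. -/
def IsSunflower {F : Type*} [Field F] {n : ℕ} (k : ℕ)
    (C : Set (Submodule F (Fin n → F))) : Prop :=
  IsSubspaceCode k C ∧
    ∃ Z : Submodule F (Fin n → F), ∀ U ∈ C, ∀ V ∈ C, U ≠ V → U ⊓ V = Z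

/-- Over a finite field the cardinalities in the definition of `maxCard` are bounded, so the
supremum is a maximum as soon as one code exists. -/
theorem bddAbove_card (F : Type*) [Field F] [Finite F] (k n c : ℕ) :
    BddAbove {m : ℕ | ∃ C : Set (Submodule F (Fin n → F)),
      IsEquidistantIntersecting k c C ∧ C.ncard = m} := by
  refine ⟨Nat.card (Submodule F (Fin n → F)), ?_⟩
  rintro m ⟨C, -, rfl⟩
  exact Set.ncard_le_card C

end SubspaceCodes

/-! For large `q`, every equidistant code with at least `q ^ (2k - 1)` members is a sunflower
(`exists_center_of_card_large`). By a second-moment count, a nonzero vector is either "low" (in at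
most `4 q ^ (k - 1)` members) or "high" (missed by at most that many). Only `O(q ^ (2k - 2))`
members meet a fixed `U` in a low vector, so some `W` has all nonzero vectors of `Z = U ⊓ W` high,
and few members miss `Z`. If even one did, at most `q ^ k` members could contain `Z`, and the code
would be too small. So all contain `Z`, which is then every pairwise intersection.

Maximum codes are this large: pulling a partial spread back along a surjection with `c`-dimensional
kernel gives `q ^ (n - k)` members, and `n ≥ 3k - 1`. Dividing a sunflower by its center inverts the
pullback, which gives the equality of the maxima. -/

namespace SubspaceCodes

open Module

/-! ### Second moments: the low/high dichotomy for vectors. -/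

section Deza

variable {F V : Type*} [Field F] [AddCommGroup V] [Module F V]

open Classical in
/-- The sum of the squares of a weighted incidence function, when all pairwise intersections have
the same cardinality. -/
theorem sum_sq_incidence [Fintype V] {k c : ℕ} {C : Finset (Submodule F V)}
    (hC : ∀ U ∈ C, finrank F U = k)
    (hI : ∀ U ∈ C, ∀ W ∈ C, U ≠ W → finrank F (U ⊓ W : Submodule F V) = c)
    (w : Submodule F V → ℤ) :
    ∑ v : V, (∑ U ∈ C, if v ∈ U then w U else 0) ^ 2 =
      (Nat.card F : ℤ) ^ c * (∑ U ∈ C, w U) ^ 2 +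
        ((Nat.card F : ℤ) ^ k - (Nat.card F : ℤ) ^ c) * ∑ U ∈ C, w U ^ 2 := by
  have key : ∀ U ∈ C, ∀ W ∈ C,
      ∑ v : V, (if v ∈ U then w U else 0) * (if v ∈ W then w W else 0) =
        (Nat.card F : ℤ) ^ c * (w U * w W) +
          if U = W then ((Nat.card F : ℤ) ^ k - (Nat.card F : ℤ) ^ c) * w U ^ 2 else 0 := by
    intro U hU W hW
    have h1 : ∑ v : V, (if v ∈ U then w U else 0) * (if v ∈ W then w W else 0) =
        ((Nat.card F ^ finrank F (U ⊓ W : Submodule F V) : ℕ) : ℤ) * (w U * w W) := by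
      rw [← Module.natCard_eq_pow_finrank (K := F), Nat.card_eq_fintype_card,
        Fintype.card_subtype, Finset.card_filter, Nat.cast_sum, Finset.sum_mul]
      refine Finset.sum_congr rfl fun v _ => ?_
      by_cases h1 : v ∈ U <;> by_cases h2 : v ∈ W <;> simp [h1, h2]
    rw [h1]
    by_cases h : U = W
    · subst h
      rw [inf_idem, hC U hU]
      push_cast
      rw [if_pos rfl]
      ring
    · rw [hI U hU W hW h]
      push_cast
      rw [if_neg h]
      ring
  calc ∑ v : V, (∑ U ∈ C, if v ∈ U then w U else 0) ^ 2
      = ∑ U ∈ C, ∑ W ∈ C,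
          ∑ v : V, (if v ∈ U then w U else 0) * (if v ∈ W then w W else 0) := by
        simp_rw [sq, Finset.sum_mul_sum]
        rw [Finset.sum_comm]
        exact Finset.sum_congr rfl fun U _ => Finset.sum_comm
    _ = ∑ U ∈ C, ∑ W ∈ C, ((Nat.card F : ℤ) ^ c * (w U * w W) +
          if U = W then ((Nat.card F : ℤ) ^ k - (Nat.card F : ℤ) ^ c) * w U ^ 2 else 0) :=
        Finset.sum_congr rfl fun U hU => Finset.sum_congr rfl fun W hW => key U hU W hW
    _ = _ := by
        simp_rw [Finset.sum_add_distrib, ← Finset.mul_sum, sq, Finset.sum_mul_sum, Finset.mul_sum]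
        congr 1
        refine Finset.sum_congr rfl fun U hU => ?_
        rw [Finset.sum_ite_eq, if_pos hU]

/-- In an equidistant family, every nonzero vector lies in few members or in almost all members. -/
theorem card_mem_or_notMem_le [Finite F] [Finite V] {k c : ℕ} (hk : 1 ≤ k)
    {C : Finset (Submodule F V)} (hC : ∀ U ∈ C, finrank F U = k)
    (hI : ∀ U ∈ C, ∀ W ∈ C, U ≠ W → finrank F (U ⊓ W : Submodule F V) = c)
    {x : V} (hx : x ≠ 0) [DecidablePred fun U : Submodule F V => x ∈ U] :
    (C.filter fun U => x ∈ U).card ≤ 4 * Nat.card F ^ (k - 1) ∨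
      (C.filter fun U => x ∉ U).card ≤ 4 * Nat.card F ^ (k - 1) := by
  classical
  have := Fintype.ofFinite V
  have := Fintype.ofFinite F
  by_contra! hcon
  obtain ⟨ha, hb⟩ := hcon
  set a := (C.filter fun U => x ∈ U).card with ha'
  set b := (C.filter fun U => x ∉ U).card with hb'
  have hsplit : ∀ y z : ℤ, (∑ U ∈ C, if x ∈ U then y else z) = a * y + b * z := by
    intro y z
    rw [Finset.sum_ite, Finset.sum_const, Finset.sum_const, nsmul_eq_mul, nsmul_eq_mul]
  -- These weights have total zero, which kills the `q ^ c` term of the second moment.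
  have hsum := sum_sq_incidence hC hI (fun U => if x ∈ U then (b : ℤ) else -(a : ℤ))
  have e1 : (∑ U ∈ C, if x ∈ U then (b : ℤ) else -(a : ℤ)) = 0 := by
    rw [hsplit]; ring
  have e2 : (∑ U ∈ C, (if x ∈ U then (b : ℤ) else -(a : ℤ)) ^ 2) = a * b ^ 2 + b * a ^ 2 := by
    simp_rw [ite_pow]
    rw [hsplit]; ring
  rw [e1, e2] at hsum
  -- Each of the `q - 1` nonzero multiples of `x` lies in the same members as `x`, so contributes
  -- `(a * b) ^ 2`.
  have hlow : ((Nat.card F : ℤ) - 1) * (a * b) ^ 2 ≤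
      ∑ v : V, (∑ U ∈ C, if v ∈ U then (if x ∈ U then (b : ℤ) else -(a : ℤ)) else 0) ^ 2 := by
    have hinj : Function.Injective fun r : Fˣ => (r : F) • x := by
      intro r s h
      exact Units.ext (smul_left_injective F hx h)
    have hcard : (Finset.univ.image fun r : Fˣ => (r : F) • x).card = Nat.card F - 1 := by
      rw [Finset.card_image_of_injective _ hinj, Finset.card_univ, Fintype.card_units,
        Nat.card_eq_fintype_card]
    have hpos : 1 ≤ Nat.card F := Nat.card_pos
    calc ((Nat.card F : ℤ) - 1) * (a * b) ^ 2
        = ∑ v ∈ Finset.univ.image fun r : Fˣ => (r : F) • x, ((a : ℤ) * b) ^ 2 := by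
          rw [Finset.sum_const, hcard, nsmul_eq_mul]
          push_cast [hpos]
          ring
      _ ≤ ∑ v ∈ Finset.univ.image fun r : Fˣ => (r : F) • x,
          (∑ U ∈ C, if v ∈ U then (if x ∈ U then (b : ℤ) else -(a : ℤ)) else 0) ^ 2 := by
          refine Finset.sum_le_sum fun v hv => ?_
          obtain ⟨r, -, rfl⟩ := Finset.mem_image.1 hv
          have : ∀ U : Submodule F V, (if (r : F) • x ∈ U then
              (if x ∈ U then (b : ℤ) else -(a : ℤ)) else 0) = if x ∈ U then (b : ℤ) else 0 := by
            intro U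
            rw [U.smul_mem_iff r.ne_zero]
            split_ifs <;> rfl
          simp_rw [this]
          rw [hsplit]
          apply le_of_eq; ring
      _ ≤ _ := Finset.sum_le_sum_of_subset_of_nonneg (Finset.subset_univ _)
          fun v _ _ => sq_nonneg _
  rw [hsum] at hlow
  have hq : (2 : ℤ) ≤ Nat.card F := by exact_mod_cast Finite.one_lt_card (α := F)
  obtain ⟨j, rfl⟩ : ∃ j, k = j + 1 := ⟨k - 1, by omega⟩
  rw [Nat.add_sub_cancel] at ha hb
  have haZ : 4 * (Nat.card F : ℤ) ^ j < a := by exact_mod_cast ha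
  have hbZ : 4 * (Nat.card F : ℤ) ^ j < b := by exact_mod_cast hb
  generalize (Nat.card F : ℤ) = q at *
  generalize (a : ℤ) = a at *
  generalize (b : ℤ) = b at *
  have hj : 0 < q ^ j := by positivity
  have hc : 0 < q ^ c := by positivity
  have ha0 : 0 < a := by linarith
  have hb0 : 0 < b := by linarith
  have h1 : (a * b) * ((q - 1) * (a * b)) ≤ (a * b) * (q ^ (j + 1) * (a + b)) := by
    have : 0 ≤ q ^ c * (a * b ^ 2 + b * a ^ 2) := by positivity
    nlinarith
  have h2 := le_of_mul_le_mul_left h1 (by positivity)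
  have h3 : q * (a * b) ≤ q * (2 * q ^ j * (a + b)) := by
    have : (q - 2) * (a * b) ≥ 0 := mul_nonneg (by linarith) (by positivity)
    rw [pow_succ] at h2
    linarith
  have h4 := le_of_mul_le_mul_left h3 (by linarith)
  nlinarith

end Deza

/-! ### Partial spreads from a field extension. -/

/-- Over a finite field there are `q ^ m` subspaces of dimension `k` of a space of
dimension `k + m` that meet pairwise trivially, if `1 ≤ k ≤ m`. -/
theorem exists_partial_spread (F : Type*) [Field F] [Finite F] {k m N : ℕ} (hk : 1 ≤ k)
    (hkm : k ≤ m) (hN : N = k + m) :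
    ∃ C : Set (Submodule F (Fin N → F)), C.ncard = Nat.card F ^ m ∧
      (∀ U ∈ C, finrank F U = k) ∧ ∀ U ∈ C, ∀ W ∈ C, U ≠ W → U ⊓ W = ⊥ := by
  obtain ⟨p, hp⟩ := CharP.exists F
  have : Fact p.Prime := ⟨CharP.char_is_prime F p⟩
  have : NeZero m := ⟨by omega⟩
  let : Algebra (ZMod p) F := ZMod.algebra F p
  let K := FiniteField.Extension F p m
  have hKf : finrank F K = m := FiniteField.finrank_extension F p m
  have hKc : Nat.card K = Nat.card F ^ m := FiniteField.natCard_extension F p m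
  let i : (Fin k → F) →ₗ[F] K :=
    (LinearEquiv.ofFinrankEq (Fin m → F) K (by simp [hKf])).toLinearMap ∘ₗ
      Function.ExtendByZero.linearMap F (Fin.castLE hkm)
  have hi : Function.Injective i := by
    refine (LinearEquiv.injective _).comp ?_
    intro f g h
    exact Function.extend_injective (Fin.castLE_injective hkm) 0 h
  let e : ((Fin k → F) × K) ≃ₗ[F] (Fin N → F) := LinearEquiv.ofFinrankEq _ _ (by simp [hKf, hN])
  -- The spread consists of the graphs of `x ↦ a * i x`, `a ∈ K`; two of them meet only at `0`
  -- because `K` has no zero divisors.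
  let φ : K → (Fin k → F) →ₗ[F] (Fin N → F) := fun a =>
    e.toLinearMap ∘ₗ LinearMap.prod LinearMap.id (LinearMap.mulLeft F a ∘ₗ i)
  have hφ : ∀ a b x y, φ a x = φ b y → x = y ∧ (x = 0 ∨ a = b) := by
    intro a b x y h
    have h' := Prod.ext_iff.1 (e.injective h)
    obtain ⟨rfl, h2⟩ := h'
    refine ⟨rfl, ?_⟩
    rcases mul_eq_mul_right_iff.1 h2 with h | h
    · exact Or.inr h
    · exact Or.inl (hi (by rw [h, map_zero]))
  have hinj : ∀ a, Function.Injective (φ a) := fun a x y h => (hφ a a x y h).1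
  have hrange : Function.Injective fun a => LinearMap.range (φ a) := by
    intro a b h
    let x : Fin k → F := fun _ => 1
    have hx : x ≠ 0 := fun h => one_ne_zero (congrFun h ⟨0, hk⟩)
    have hm : φ a x ∈ LinearMap.range (φ b) := by
      rw [← show LinearMap.range (φ a) = LinearMap.range (φ b) from h]
      exact ⟨x, rfl⟩
    obtain ⟨y, hy⟩ := hm
    exact (hφ a b x y hy.symm).2.resolve_left hx
  refine ⟨Set.range fun a => LinearMap.range (φ a), ?_, ?_, ?_⟩
  · rw [← Set.image_univ, Set.ncard_image_of_injective _ hrange, Set.ncard_univ, hKc]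
  · rintro _ ⟨a, rfl⟩
    rw [LinearMap.finrank_range_of_inj (hinj a), finrank_fin_fun]
  · rintro _ ⟨a, rfl⟩ _ ⟨b, rfl⟩ hab
    rw [Submodule.eq_bot_iff]
    rintro _ ⟨⟨x, rfl⟩, ⟨y, hy⟩⟩
    rcases (hφ a b x y hy.symm).2 with h | h
    · rw [h, map_zero]
    · exact absurd (by rw [h]) hab

/-! ### Intersection dimensions and transfer along quotient maps. -/

/-- A code is equidistant and `c`-intersecting iff its members meet pairwise in dimension `c`. -/
theorem isEquidistantIntersecting_iff {F : Type*} [Field F] {n k c : ℕ} (hc : c ≤ k)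
    {C : Set (Submodule F (Fin n → F))} :
    IsEquidistantIntersecting k c C ↔ IsSubspaceCode k C ∧
      ∀ U ∈ C, ∀ V ∈ C, U ≠ V → finrank F (U ⊓ V : Submodule F (Fin n → F)) = c := by
  have hle : ∀ U V : Submodule F (Fin n → F),
      finrank F (U ⊓ V : Submodule F (Fin n → F)) ≤ finrank F U := fun U V =>
    Submodule.finrank_mono inf_le_left
  constructor
  · rintro ⟨⟨h1, h2⟩, h3⟩
    refine ⟨h1, fun U hU V hV hUV => ?_⟩
    have h4 := h2 U hU V hV hUV
    have h5 := hle U V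
    rw [subspaceDist, h1.1 U hU, h1.1 V hV] at h4
    rw [h1.1 U hU] at h5
    omega
  · rintro ⟨h1, h2⟩
    have hd : ∀ U ∈ C, ∀ V ∈ C, U ≠ V → subspaceDist U V = 2 * (k - c) := by
      intro U hU V hV hUV
      rw [subspaceDist, h1.1 U hU, h1.1 V hV, h2 U hU V hV hUV]
      omega
    have hmin : minDist C = 2 * (k - c) := by
      obtain ⟨U, hU, V, hV, hUV⟩ := (Set.one_lt_ncard_iff_nontrivial_and_finite.1 h1.2).1
      have : {d : ℕ | ∃ U ∈ C, ∃ V ∈ C, U ≠ V ∧ d = subspaceDist U V} = {2 * (k - c)} := by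
        ext d
        constructor
        · rintro ⟨U, hU, V, hV, hUV, rfl⟩
          exact hd U hU V hV hUV
        · rintro rfl
          exact ⟨U, hU, V, hV, hUV, (hd U hU V hV hUV).symm⟩
      rw [minDist, this, csInf_singleton]
    refine ⟨⟨h1, fun U hU V hV hUV => ?_⟩, ?_⟩
    · rw [hmin, hd U hU V hV hUV]
    · rw [hmin]
      omega

theorem le_maxCard {F : Type*} [Field F] [Finite F] {n k c : ℕ}
    {C : Set (Submodule F (Fin n → F))} (hC : IsEquidistantIntersecting k c C) :
    C.ncard ≤ maxCard F k n c :=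
  le_csSup (bddAbove_card F k n c) ⟨C, hC, rfl⟩

theorem exists_ncard_eq_maxCard {F : Type*} [Field F] [Finite F] {n k c : ℕ}
    {D : Set (Submodule F (Fin n → F))} (hD : IsEquidistantIntersecting k c D) :
    ∃ C : Set (Submodule F (Fin n → F)),
      IsEquidistantIntersecting k c C ∧ C.ncard = maxCard F k n c :=
  Nat.sSup_mem (s := {m : ℕ | ∃ C : Set (Submodule F (Fin n → F)),
    IsEquidistantIntersecting k c C ∧ C.ncard = m}) ⟨_, D, hD, rfl⟩ (bddAbove_card F k n c)

theorem finrank_comap_of_surjective {F V W : Type*} [Field F] [AddCommGroup V] [Module F V]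
    [AddCommGroup W] [Module F W] [FiniteDimensional F V] {π : V →ₗ[F] W}
    (hπ : Function.Surjective π) (U : Submodule F W) :
    finrank F (U.comap π) = finrank F U + finrank F (LinearMap.ker π) := by
  have h := LinearMap.finrank_range_add_finrank_ker (π.domRestrict (U.comap π))
  rw [LinearMap.range_domRestrict, Submodule.map_comap_eq_of_surjective hπ,
    LinearMap.ker_domRestrict] at h
  rw [← h]
  congr 1
  refine LinearEquiv.finrank_eq (Submodule.comapSubtypeEquivOfLe
    (p := LinearMap.ker π) (q := U.comap π) ?_)
  intro x hx
  rw [Submodule.mem_comap, LinearMap.mem_ker.1 hx]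
  exact U.zero_mem

/-- Pullback along a surjection is injective on subspaces, commutes with intersection and adds the
kernel's dimension throughout. -/
theorem isEquidistantIntersecting_comap {F : Type*} [Field F] [Finite F] {n m k c d : ℕ}
    (hd : d ≤ k) {π : (Fin n → F) →ₗ[F] (Fin m → F)} (hπ : Function.Surjective π)
    (hker : finrank F (LinearMap.ker π) = c) {C : Set (Submodule F (Fin m → F))} :
    IsEquidistantIntersecting (k + c) (d + c) (Submodule.comap π '' C) ↔
      IsEquidistantIntersecting k d C := by
  rw [isEquidistantIntersecting_iff hd, isEquidistantIntersecting_iff (by omega)]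
  have hinj := Submodule.comap_injective_of_surjective hπ
  have hinf : ∀ U W : Submodule F (Fin m → F),
      finrank F (U.comap π ⊓ W.comap π : Submodule F (Fin n → F)) =
        finrank F (U ⊓ W : Submodule F (Fin m → F)) + c := by
    intro U W
    rw [← Submodule.comap_inf, finrank_comap_of_surjective hπ, hker]
  unfold IsSubspaceCode
  rw [Set.ncard_image_of_injective _ hinj]
  simp only [Set.forall_mem_image, hinj.ne_iff, hinf,
    finrank_comap_of_surjective hπ, hker, add_left_inj]

theorem exists_surjective_ker_eq {F : Type*} [Field F] {n c : ℕ} (Z : Submodule F (Fin n → F))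
    (hZ : finrank F Z = c) :
    ∃ π : (Fin n → F) →ₗ[F] (Fin (n - c) → F), Function.Surjective π ∧ LinearMap.ker π = Z := by
  have h := Z.finrank_quotient_add_finrank
  rw [finrank_fin_fun] at h
  let e : ((Fin n → F) ⧸ Z) ≃ₗ[F] (Fin (n - c) → F) :=
    LinearEquiv.ofFinrankEq _ _ (by rw [finrank_fin_fun]; omega)
  refine ⟨e.toLinearMap ∘ₗ Z.mkQ, e.surjective.comp Z.mkQ_surjective, ?_⟩
  rw [LinearEquiv.ker_comp, Submodule.ker_mkQ]

/-! ### Large equidistant families are sunflowers. -/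

open Classical in
/-- Few members of an equidistant family miss a subspace all of whose vectors are in almost all
members. -/
theorem card_not_le_le {F V : Type*} [Field F] [AddCommGroup V] [Module F V]
    [FiniteDimensional F V] {C : Finset (Submodule F V)} {Z : Submodule F V} {N : ℕ}
    (h : ∀ x ∈ Z, x ≠ 0 → (C.filter fun U => x ∉ U).card ≤ N) :
    (C.filter fun U => ¬ Z ≤ U).card ≤ finrank F Z * N := by
  let b := finBasis F Z
  have hsub : (C.filter fun U => ¬ Z ≤ U) ⊆
      Finset.univ.biUnion fun i => C.filter fun U => (b i : V) ∉ U := by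
    intro U hU
    rw [Finset.mem_filter] at hU
    by_contra hcon
    refine hU.2 fun z hz => ?_
    have hb : ∀ i, (b i : V) ∈ U := by
      intro i
      by_contra hi
      exact hcon (Finset.mem_biUnion.2 ⟨i, Finset.mem_univ _, Finset.mem_filter.2 ⟨hU.1, hi⟩⟩)
    have hz' := congrArg Subtype.val (b.sum_repr ⟨z, hz⟩)
    rw [← show _ = z from hz', Submodule.coe_sum]
    exact U.sum_mem fun i _ => U.smul_mem _ (hb i)
  calc _ ≤ _ := Finset.card_le_card hsub
    _ ≤ ∑ i, (C.filter fun U => (b i : V) ∉ U).card := Finset.card_biUnion_le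
    _ ≤ ∑ _i : Fin (finrank F Z), N := Finset.sum_le_sum fun i _ =>
        h _ (b i).2 fun h0 => b.ne_zero i (Subtype.ext h0)
    _ = _ := by simp

open Classical in
/-- If a member `W` of an equidistant family does not contain a subspace `Z` of the dimension of
the intersections, then at most `|W|` members contain `Z`. -/
theorem card_le_le_of_not_le {F V : Type*} [Field F] [Finite F] [AddCommGroup V] [Module F V]
    [Finite V] {k c : ℕ} {C : Finset (Submodule F V)}
    (hC : ∀ U ∈ C, finrank F U = k)
    (hI : ∀ U ∈ C, ∀ W ∈ C, U ≠ W → finrank F (U ⊓ W : Submodule F V) = c)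
    {Z W : Submodule F V} (hZ : finrank F Z = c) (hW : W ∈ C) (hZW : ¬ Z ≤ W) :
    (C.filter fun U => Z ≤ U).card ≤ Nat.card F ^ k := by
  have := Fintype.ofFinite V
  have : ∀ U ∈ C.filter (fun U => Z ≤ U), ∃ v, v ∈ U ∧ v ∈ W ∧ v ∉ Z := by
    intro U hU
    rw [Finset.mem_filter] at hU
    have hne : U ≠ W := by
      rintro rfl
      exact hZW hU.2
    have h1 := hI U hU.1 W hW hne
    by_contra! hcon
    have h2 : U ⊓ W ≤ Z := fun v hv => hcon v hv.1 hv.2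
    have h3 := Submodule.eq_of_le_of_finrank_eq h2 (h1.trans hZ.symm)
    exact hZW (h3 ▸ inf_le_right)
  choose! f hf using this
  rw [← hC W hW, ← Module.natCard_eq_pow_finrank (K := F), Nat.card_eq_fintype_card,
    Fintype.card_subtype]
  -- Distinct members containing `Z` meet exactly in `Z`, so they cannot share a vector outside `Z`.
  refine Finset.card_le_card_of_injOn f (fun U hU => by simpa using (hf U hU).2.1) ?_
  intro U hU U' hU' h
  by_contra hne
  have hU1 := Finset.mem_filter.1 hU
  have hU2 := Finset.mem_filter.1 hU'
  have h3 := Submodule.eq_of_le_of_finrank_eq (le_inf hU1.2 hU2.2)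
    (hZ.trans (hI U hU1.1 U' hU2.1 hne).symm)
  refine (hf U hU).2.2 ?_
  rw [h3]
  exact ⟨(hf U hU).1, h ▸ (hf U' hU').1⟩

open Classical in
/-- Few members of a family `C` meet `U` in a nonzero vector that is in few members of `C`. -/
theorem card_exists_low_le {F V : Type*} [Field F] [Finite F] [AddCommGroup V] [Module F V]
    [Finite V] {k : ℕ} (hk : 1 ≤ k) {C S : Finset (Submodule F V)} {U : Submodule F V}
    (hU : finrank F U = k) (hSC : S ⊆ C)
    (hS : ∀ W ∈ S, ∃ v ∈ U, v ∈ W ∧ v ≠ 0 ∧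
      (C.filter fun W' => v ∈ W').card ≤ 4 * Nat.card F ^ (k - 1)) :
    S.card ≤ 8 * Nat.card F ^ (2 * k - 2) := by
  have := Fintype.ofFinite V
  have := Fintype.ofFinite F
  set q := Nat.card F with hq
  set N := 4 * q ^ (k - 1) with hN
  set T := Finset.univ.filter fun v : V => v ∈ U ∧ v ≠ 0 ∧ (C.filter fun W' => v ∈ W').card ≤ N
    with hT
  have hTc : T.card ≤ q ^ k := by
    rw [← hU, hq, ← Module.natCard_eq_pow_finrank (K := F), Nat.card_eq_fintype_card,
      Fintype.card_subtype]
    exact Finset.card_le_card fun v hv => by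
      simp only [hT, Finset.mem_filter] at hv ⊢
      exact ⟨hv.1, hv.2.1⟩
  have hq2 : 2 ≤ q := Finite.one_lt_card (α := F)
  -- Double count incidences of members of `S` with low vectors of `U`; each member has a whole
  -- punctured line of them.
  have key : S.card * (q - 1) ≤ T.card * N := by
    refine Finset.card_mul_le_card_mul (fun (W : Submodule F V) v => v ∈ W) ?_ ?_
    · intro W hW
      obtain ⟨v, hvU, hvW, hv0, hvN⟩ := hS W hW
      have hinj : Function.Injective fun r : Fˣ => (r : F) • v := fun r s h =>
        Units.ext (smul_left_injective F hv0 h)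
      rw [hq, Nat.card_eq_fintype_card, ← Fintype.card_units, ← Finset.card_univ,
        ← Finset.card_image_of_injective _ hinj]
      refine Finset.card_le_card fun w hw => ?_
      obtain ⟨r, -, rfl⟩ := Finset.mem_image.1 hw
      have hmem : ∀ X : Submodule F V, (r : F) • v ∈ X ↔ v ∈ X := fun X =>
        X.smul_mem_iff r.ne_zero
      simp only [Finset.mem_bipartiteAbove, hT, Finset.mem_filter, Finset.mem_univ, true_and, hmem]
      exact ⟨⟨hvU, smul_ne_zero r.ne_zero hv0, hvN⟩, hvW⟩
    · intro v hv
      refine (Finset.card_le_card ?_).trans (Finset.mem_filter.1 hv).2.2.2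
      intro W hW
      rw [Finset.mem_bipartiteBelow] at hW
      exact Finset.mem_filter.2 ⟨hSC hW.1, hW.2⟩
  obtain ⟨j, rfl⟩ : ∃ j, k = j + 1 := ⟨k - 1, by omega⟩
  rw [Nat.add_sub_cancel] at hN
  rw [show 2 * (j + 1) - 2 = j + j by omega, pow_add]
  rw [pow_succ] at hTc
  have h2 : q * S.card ≤ q * (8 * (q ^ j * q ^ j)) := by
    calc q * S.card ≤ (2 * (q - 1)) * S.card := Nat.mul_le_mul_right _ (by omega)
      _ = 2 * (S.card * (q - 1)) := by ring
      _ ≤ 2 * (T.card * N) := Nat.mul_le_mul_left _ key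
      _ ≤ 2 * ((q ^ j * q) * N) := by gcongr
      _ = _ := by rw [hN]; ring
  exact Nat.le_of_mul_le_mul_left h2 (zero_lt_two.trans_le hq2)

/-- A large equidistant family is a sunflower. -/
theorem exists_center_of_card_large {F V : Type*} [Field F] [Finite F] [AddCommGroup V]
    [Module F V] [Finite V] {k c : ℕ} (hc : c < k) {C : Finset (Submodule F V)}
    (hC : ∀ U ∈ C, finrank F U = k)
    (hI : ∀ U ∈ C, ∀ W ∈ C, U ≠ W → finrank F (U ⊓ W : Submodule F V) = c)
    (hq : 4 * k + 10 ≤ Nat.card F) (hcard : Nat.card F ^ (2 * k - 1) ≤ C.card) :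
    ∃ Z : Submodule F V, ∀ U ∈ C, ∀ W ∈ C, U ≠ W → U ⊓ W = Z := by
  classical
  rcases Nat.eq_zero_or_pos c with rfl | hc0
  · exact ⟨⊥, fun U hU W hW h => Submodule.finrank_eq_zero.1 (hI U hU W hW h)⟩
  set q := Nat.card F with hqdef
  obtain ⟨j, rfl⟩ : ∃ j, k = j + 2 := ⟨k - 2, by omega⟩
  have hpos : 0 < q ^ (2 * j + 2) := pow_pos Nat.card_pos _
  -- The factor beats both bounds contradicted below: `8 q ^ (2k - 2) + 1` and `q ^ k + 4 c q ^ (k -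
  -- 1)`. The latter needs `k ≤ 2k - 2`, hence the separate case `c = 0`.
  have hbig : (4 * (j + 2) + 10) * q ^ (2 * j + 2) ≤ C.card := by
    refine le_trans ?_ hcard
    rw [show 2 * (j + 2) - 1 = (2 * j + 2) + 1 by omega, pow_succ, mul_comm]
    exact Nat.mul_le_mul_left _ hq
  have hp1 : q ^ (j + 1) ≤ q ^ (2 * j + 2) := Nat.pow_le_pow_right (by omega) (by omega)
  have hp2 : q ^ (j + 2) ≤ q ^ (2 * j + 2) := Nat.pow_le_pow_right (by omega) (by omega)
  obtain ⟨U, hU⟩ : C.Nonempty := Finset.card_pos.1 (by nlinarith)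
  obtain ⟨W, hW, hWU, hWhigh⟩ : ∃ W ∈ C, W ≠ U ∧ ∀ v ∈ U ⊓ W, v ≠ 0 →
      (C.filter fun W' => v ∉ W').card ≤ 4 * q ^ (j + 1) := by
    by_contra! hcon
    have h1 : (C.erase U).card ≤ 8 * q ^ (2 * (j + 2) - 2) := by
      refine card_exists_low_le (by omega) (hC U hU) (Finset.erase_subset U C) fun W hW => ?_
      rw [Finset.mem_erase] at hW
      obtain ⟨v, hv, hv0, hvN⟩ := hcon W hW.2 hW.1
      refine ⟨v, hv.1, hv.2, hv0, ?_⟩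
      exact (card_mem_or_notMem_le (by omega) hC hI hv0).resolve_right (not_le.2 hvN)
    rw [show 2 * (j + 2) - 2 = 2 * j + 2 by omega] at h1
    rw [Finset.card_erase_of_mem hU, Nat.sub_le_iff_le_add] at h1
    nlinarith
  have hZ := hI U hU W hW hWU.symm
  set Z := U ⊓ W with hZdef
  have hmiss := card_not_le_le (F := F) hWhigh
  rw [hZ] at hmiss
  have hall : ∀ X ∈ C, Z ≤ X := by
    intro X hX
    by_contra hnot
    have h1 := card_le_le_of_not_le hC hI hZ hX hnot
    have h2 := Finset.card_filter_add_card_filter_not (s := C) (fun X => Z ≤ X)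
    have h3 : c * (4 * q ^ (j + 1)) ≤ (j + 2) * (4 * q ^ (2 * j + 2)) :=
      Nat.mul_le_mul hc.le (Nat.mul_le_mul_left _ hp1)
    rw [← hqdef] at h1
    nlinarith
  refine ⟨Z, fun X hX Y hY hXY => ?_⟩
  exact (Submodule.eq_of_le_of_finrank_eq (le_inf (hall X hX) (hall Y hY))
    (hZ.trans (hI X hX Y hY hXY).symm)).symm

/-! ### Reduction to trivially intersecting codes. -/

/-- A sunflower code with `c`-dimensional center is the preimage of a partial spread code. -/
theorem ncard_le_maxCard_of_isSunflower {F : Type*} [Field F] [Finite F] {k n c : ℕ} (hc : c ≤ k)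
    {C : Set (Submodule F (Fin n → F))} (hC : IsEquidistantIntersecting k c C)
    (hS : IsSunflower k C) : C.ncard ≤ maxCard F (k - c) (n - c) 0 := by
  obtain ⟨hcode, hI⟩ := (isEquidistantIntersecting_iff hc).1 hC
  obtain ⟨-, Z, hZ⟩ := hS
  have hnt := (Set.one_lt_ncard_iff_nontrivial_and_finite.1 hcode.2).1
  have hZc : finrank F Z = c := by
    obtain ⟨U, hU, W, hW, hUW⟩ := hnt
    rw [← hZ U hU W hW hUW, hI U hU W hW hUW]
  have hle : ∀ U ∈ C, Z ≤ U := by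
    intro U hU
    obtain ⟨W, hW, hWU⟩ := hnt.exists_ne U
    rw [← hZ U hU W hW hWU.symm]
    exact inf_le_left
  obtain ⟨π, hπ, hker⟩ := exists_surjective_ker_eq Z hZc
  have hDC : Submodule.comap π '' (Submodule.map π '' C) = C := by
    rw [Set.image_image]
    refine (Set.image_congr fun U hU => ?_).trans (Set.image_id C)
    rw [Submodule.comap_map_eq, hker, sup_eq_left.2 (hle U hU), id]
  have hD : IsEquidistantIntersecting (k - c) 0 (Submodule.map π '' C) := by
    rw [← isEquidistantIntersecting_comap (Nat.zero_le _) hπ (hker ▸ hZc), hDC, zero_add,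
      Nat.sub_add_cancel hc]
    exact hC
  rw [← hDC, Set.ncard_image_of_injective _ (Submodule.comap_injective_of_surjective hπ)]
  exact le_maxCard hD

/-- Preimages of partial spread codes are sunflower codes. -/
theorem exists_comap_code {F : Type*} [Field F] [Finite F] {k n c : ℕ} (hc : c ≤ k) (hn : c ≤ n)
    {D : Set (Submodule F (Fin (n - c) → F))} (hD : IsEquidistantIntersecting (k - c) 0 D) :
    ∃ C : Set (Submodule F (Fin n → F)), IsEquidistantIntersecting k c C ∧ C.ncard = D.ncard := by
  let π : (Fin n → F) →ₗ[F] (Fin (n - c) → F) :=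
    LinearMap.funLeft F F (Fin.castLE (Nat.sub_le n c))
  have hπ : Function.Surjective π :=
    LinearMap.funLeft_surjective_of_injective F F _ (Fin.castLE_injective _)
  have hker : finrank F (LinearMap.ker π) = c := by
    have h := LinearMap.finrank_range_add_finrank_ker π
    rw [LinearMap.range_eq_top.2 hπ, finrank_top, finrank_fin_fun, finrank_fin_fun] at h
    omega
  refine ⟨Submodule.comap π '' D, ?_,
    Set.ncard_image_of_injective _ (Submodule.comap_injective_of_surjective hπ)⟩
  have := (isEquidistantIntersecting_comap (Nat.zero_le _) hπ hker).2 hD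
  rwa [zero_add, Nat.sub_add_cancel hc] at this

end SubspaceCodes

theorem mainTheorem4 (k n : ℕ) (hk : 1 ≤ k) (hn : 3 * k - 1 ≤ n) :
    ∃ Q : ℕ, ∀ c : ℕ, c < k →
      ∀ (F : Type*) [Field F] [Finite F], Q ≤ Nat.card F →
        SubspaceCodes.maxCard F k n c = SubspaceCodes.maxCard F (k - c) (n - c) 0 ∧
        ∀ C : Set (Submodule F (Fin n → F)),
          SubspaceCodes.IsEquidistantIntersecting k c C →
          C.ncard = SubspaceCodes.maxCard F k n c →
          SubspaceCodes.IsSunflower k C := by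
  refine ⟨4 * k + 10, fun c hc F _ _ hq => ?_⟩
  obtain ⟨D, hDcard, hDdim, hDI⟩ := SubspaceCodes.exists_partial_spread F
    (k := k - c) (m := n - k) (N := n - c) (by omega) (by omega) (by omega)
  have hDcode : SubspaceCodes.IsEquidistantIntersecting (k - c) 0 D := by
    refine (SubspaceCodes.isEquidistantIntersecting_iff (Nat.zero_le _)).2 ⟨⟨hDdim, ?_⟩, ?_⟩
    · rw [hDcard]
      exact le_trans (by omega) (Nat.le_self_pow (n := n - k) (by omega) (Nat.card F))
    · intro U hU W hW hUW
      rw [hDI U hU W hW hUW, finrank_bot]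
  obtain ⟨E, hE, hEcard⟩ := SubspaceCodes.exists_ncard_eq_maxCard hDcode
  obtain ⟨E', hE', hE'card⟩ := SubspaceCodes.exists_comap_code hc.le (by omega) hE
  have hge : SubspaceCodes.maxCard F (k - c) (n - c) 0 ≤ SubspaceCodes.maxCard F k n c := by
    rw [← hEcard, ← hE'card]
    exact SubspaceCodes.le_maxCard hE'
  -- The hypothesis `n ≥ 3k - 1` is exactly `2k - 1 ≤ n - k`.
  have hlarge : Nat.card F ^ (2 * k - 1) ≤ SubspaceCodes.maxCard F k n c :=
    calc Nat.card F ^ (2 * k - 1) ≤ Nat.card F ^ (n - k) :=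
          Nat.pow_le_pow_right (by omega) (by omega)
      _ = D.ncard := hDcard.symm
      _ ≤ _ := SubspaceCodes.le_maxCard hDcode
      _ ≤ _ := hge
  have hsun : ∀ C : Set (Submodule F (Fin n → F)),
      SubspaceCodes.IsEquidistantIntersecting k c C →
      C.ncard = SubspaceCodes.maxCard F k n c → SubspaceCodes.IsSunflower k C := by
    intro C hC hmax
    obtain ⟨hcode, hI⟩ := (SubspaceCodes.isEquidistantIntersecting_iff hc.le).1 hC
    have hfin : C.Finite := Set.toFinite C
    refine ⟨hcode, ?_⟩
    have h := SubspaceCodes.exists_center_of_card_large (C := hfin.toFinset) hc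
      (by simpa using hcode.1) (by simpa using hI) hq
      (by rw [← Set.ncard_eq_toFinset_card C hfin, hmax]; exact hlarge)
    simpa using h
  obtain ⟨C, hC, hCcard⟩ := SubspaceCodes.exists_ncard_eq_maxCard hE'
  refine ⟨le_antisymm ?_ hge, hsun⟩
  rw [← hCcard]
  exact SubspaceCodes.ncard_le_maxCard_of_isSunflower hc.le hC (hsun C hC hCcard)
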